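/- Let $F$ be a field of characteristic $0$ and let $q\in F$, $q\neq 0$ (for a formal parameter take $F=K(q)$). Let $\mathbf{Sym}$ be the free associative $F$-algebra on the complete noncommutative symmetric functions $S_1,S_2,\dots$ (with $S_0=1$). Let $\Psi_n$ be the power sums of the first kind, defined by $nS_n=\sum_{k=1}^{n}S_{n-k}\Psi_k$. For a composition $I=(i_1,\dots,i_r)$ let $\Psi_I$ be Tevlin's noncommutative monomial function: $\Psi_\emptyset=1$, and for $r\ge 1$, $\Psi_I=\frac{(-1)^{r-1}}{r}|A|_{r,1}$, where $|A|_{r,1}$ is the quasideterminant, with respect to the lower left entry, of the $r\times r$ matrix $A$ with entries $A_{a,b}=\Psi_{i_{r-a+1}+\cdots+i_{r-b+1}}$ for $b\le a$, $A_{a,a+1}=a$, and $0$ elsewhere. The $\Psi_I$ form a linear basis of $\mathbf{Sym}$. Let $\mathbf{WQSym}$ have the basis $(\mathbf{M}_u)$ indexed by packed words, with product $\mathbf{M}_u\mathbf{M}_v=\sum_z\mathbf{M}_z$ over the packed words $z=x\cdot y$ with $\mathrm{pack}(x)=u$, $\mathrm{pack}(y)=v$. Let $\mathrm{sinv}(u)$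 be the number of pairs $i<j$ with $u_i>u_j$ such that $u_j$ is the rightmost occurrence of its letter in $u$. Put $\phi_q(\mathbf{M}_u)=q^{\mathrm{sinv}(u)}\mathbf{M}_u$, and let $\star_q$ be the (associative) product with $\phi_q(f)\star_q\phi_q(g)=\phi_q(fg)$. Let $\tilde S_n=\sum_u \mathbf{M}_u$ over the nondecreasing packed words $u$ of length $n$, let $\zeta:\mathbf{WQSym}\to\mathbf{Sym}$ be the linear map $\mathbf{M}_u\mapsto\Psi_{\mathrm{WC}(u)}$, where $\mathrm{WC}(u)$ is the composition whose descent set is given by the positions of the last occurrences of the letters of $u$, and for a composition $J=(j_1,\dots,j_l)$ put $$S^J(q)=\zeta(\tilde S_{j_1}\star_q\cdots\star_q\tilde S_{j_l}),\qquad S^\emptyset(q)=1.$$ Let $C_I^J(q)\in F$ be the coefficient of $\Psi_I$ in $S^J(q)$. Theorem. Let $I=(i_1,\dots,i_k)$ and $J=(j_1,\dots,j_l)$ be compositions of the same integer $n$. Then $C_\emptyset^\emptyset(q)=1$, and for $n\ge 1$: (i) if $i_1<j_1$ (so that $k\ge 2$), then $C_I^J(q)=C_{(i_1+i_2,i_3,\dots,i_k)}^J(q)$;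 (ii) if $i_1\ge j_1$, then $$C_I^J(q)=\binom{k+j_1-1}{j_1}_q\,C_{I'}^{(j_2,\dots,j_l)}(q),$$ where $\binom{a}{b}_q$ is the $q$-binomial coefficient and the diagram of $I'$ is obtained by removing the first $j_1$ cells of the diagram of $I$, i.e. $I'=(i_1-j_1,i_2,\dots,i_k)$ if $i_1>j_1$ and $I'=(i_2,\dots,i_k)$ if $i_1=j_1$. Moreover, for all compositions $I,J$ of the same integer there is a finite list of pairs $(a_t,b_t)$ of integers with $0\le b_t\le a_t$, depending only on $I$ and $J$ (not on $F$ or $q$), such that $C_I^J(q)=\prod_t\binom{a_t}{b_t}_q$. -/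

import Mathlib

noncomputable section

namespace TevlinHL

/-! ### Compositions -/

/-- A composition is a finite sequence of positive integers. -/
abbrev Comp := List ℕ+

/-- The sum of the parts. -/
def Comp.weight (I : Comp) : ℕ := (I.map (fun i : ℕ+ => (i : ℕ))).sum

/-- Removal of the first `m` cells of the (ribbon) diagram of a composition. The diagram has
rows of lengths `i₁, i₂, …`, and its cells are numbered row after row. -/
def removeCells : ℕ → Comp → Comp
  | _, [] => []
  | m, i :: I => if h : m < i then Nat.toPNat (i - m) (by omega) :: I
      else removeCells (m - i) I

/-! ### Noncommutative symmetric functions and the monomial functions `Ψ_I` -/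

/-- The algebra of noncommutative symmetric functions over `F`: the free associative algebra on
the complete functions `S_1, S_2, …`. -/
abbrev NSym (F : Type*) [Field F] := FreeAlgebra F ℕ+

section NSym

variable (F : Type*) [Field F]

/-- The complete functions `S_n`, with `S_0 = 1`. -/
def completeS (n : ℕ) : NSym F :=
  if h : 0 < n then FreeAlgebra.ι F (n.toPNat h) else 1

/-- The power sums of the first kind `Ψ_n` (`n ≥ 1`), defined by the Newton relations
`n S_n = S_{n-1} Ψ_1 + S_{n-2} Ψ_2 + ⋯ + S_1 Ψ_{n-1} + Ψ_n`. -/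
def powerSum (n : ℕ) : NSym F :=
  (n : NSym F) * completeS F n -
    ∑ k : Fin n, if (k : ℕ) = 0 then 0 else completeS F (n - k) * powerSum k
  termination_by n
  decreasing_by exact k.2

/-- The quasideterminant `|A|_{pq} = a_{pq} - r (A^{pq})⁻¹ c` of a matrix over a noncommutative
ring; `A^{pq}` is `A` without row `p` and column `q`, `r` is row `p` of `A` without `a_{pq}`, and
`c` is column `q` of `A` without `a_{pq}`. -/
def quasidet {R : Type*} [Ring R] {n : ℕ} (A : Matrix (Fin (n + 1)) (Fin (n + 1)) R)
    (p q : Fin (n + 1)) : R :=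
  A p q - (fun j => A p (q.succAbove j)) ⬝ᵥ
    (Matrix.mulVec (Ring.inverse (A.submatrix p.succAbove q.succAbove))
      (fun i => A (p.succAbove i) q))

/-- For a composition `I = (i_1, …, i_r)` with `r = m + 1`, the `r × r` matrix

`Ψ_{i_r}               1                     0  …  0`
`Ψ_{i_{r-1}+i_r}       Ψ_{i_{r-1}}           2  …  0`
`⋮                                                 ⋮`
`Ψ_{i_2+⋯+i_r}         Ψ_{i_2+⋯+i_{r-1}}     …     r-1`
`Ψ_{i_1+⋯+i_r}         Ψ_{i_1+⋯+i_{r-1}}     …     Ψ_{i_1}`. -/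
def tevlinMatrix (I : Comp) (m : ℕ) : Matrix (Fin (m + 1)) (Fin (m + 1)) (NSym F) :=
  Matrix.of fun a b =>
    if (b : ℕ) ≤ a then powerSum F (Comp.weight ((I.drop (m - a)).take (a + 1 - b)))
    else if (b : ℕ) = a + 1 then ((a + 1 : ℕ) : NSym F) else 0

/-- Tevlin's noncommutative monomial symmetric functions: `Ψ_∅ = 1`, and for a composition of
length `r ≥ 1`, `Ψ_I` is `(-1)^{r-1} / r` times the quasideterminant of the matrix above with
respect to its lower left entry. -/
def monomialPsi : Comp → NSym F
  | [] => 1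
  | i :: I => ((-1) ^ I.length * ((I.length + 1 : ℕ) : F)⁻¹) •
      quasidet (tevlinMatrix F (i :: I) I.length) (Fin.last _) 0

end NSym

/-! ### Proof that the `Ψ_I` form a basis -/

theorem quasidet_eq {R : Type*} [Ring R] {n : ℕ} (A : Matrix (Fin (n + 1)) (Fin (n + 1)) R)
    (p q : Fin (n + 1)) (hu : IsUnit (A.submatrix p.succAbove q.succAbove))
    (x : Fin (n + 1) → R) (hx : x q = 1)
    (h : ∀ i, ∑ j, A (p.succAbove i) j * x j = 0) :
    quasidet A p q = ∑ j, A p j * x j := by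
  have key : Matrix.mulVec (A.submatrix p.succAbove q.succAbove) (fun j => x (q.succAbove j)) =
      - (fun i => A (p.succAbove i) q) := by
    funext i
    have := h i
    rw [Fin.sum_univ_succAbove _ q, hx, mul_one] at this
    simp only [Matrix.mulVec, dotProduct, Matrix.submatrix_apply, Pi.neg_apply]
    exact eq_neg_of_add_eq_zero_right this
  have key2 : (fun j => x (q.succAbove j)) =
      - Matrix.mulVec (Ring.inverse (A.submatrix p.succAbove q.succAbove))
        (fun i => A (p.succAbove i) q) := by
    rw [← Matrix.mulVec_neg, ← key, Matrix.mulVec_mulVec, Ring.inverse_mul_cancel _ hu,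
      Matrix.one_mulVec]
  rw [Fin.sum_univ_succAbove _ q, hx, mul_one]
  have : ∑ i, A p (q.succAbove i) * x (q.succAbove i) =
      (fun j => A p (q.succAbove j)) ⬝ᵥ (fun j => x (q.succAbove j)) := rfl
  rw [this, key2, dotProduct_neg, quasidet, sub_eq_add_neg]

theorem isUnit_of_lower {R : Type*} [Ring R] {n : ℕ} (A : Matrix (Fin n) (Fin n) R)
    (hlow : ∀ i j, i < j → A i j = 0) (hdiag : ∀ i, IsUnit (A i i)) : IsUnit A := by
  choose d hd using hdiag
  let D : Matrix (Fin n) (Fin n) R := Matrix.diagonal fun i => (d i : R)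
  let E : Matrix (Fin n) (Fin n) R := Matrix.diagonal fun i => ((d i)⁻¹ : Rˣ)
  have hDE : D * E = 1 := by simp [D, E, Matrix.diagonal_mul_diagonal]
  have hED : E * D = 1 := by simp [D, E, Matrix.diagonal_mul_diagonal]
  have hD : IsUnit D := ⟨⟨D, E, hDE, hED⟩, rfl⟩
  let N := E * A - 1
  have hN : ∀ i j, i ≤ j → N i j = 0 := by
    intro i j hij
    rcases hij.lt_or_eq with h | h
    · simp [N, E, Matrix.diagonal_mul, hlow i j h, h.ne]
    · subst h
      simp [N, E, Matrix.diagonal_mul, ← hd i]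
  have hpow : ∀ m : ℕ, ∀ i j : Fin n, (i : ℕ) < j + m → (N ^ m) i j = 0 := by
    intro m
    induction m with
    | zero =>
      intro i j hij
      have : i ≠ j := by intro h; subst h; simp at hij
      simp [this]
    | succ m ih =>
      intro i j hij
      rw [pow_succ, Matrix.mul_apply]
      refine Finset.sum_eq_zero fun k _ => ?_
      by_cases h : (i : ℕ) < k + m
      · rw [ih i k h, zero_mul]
      · rw [hN k j (by rw [Fin.le_def]; omega), mul_zero]
  have hnil : IsNilpotent N := ⟨n, by
    ext i j
    exact hpow n i j (by omega)⟩
  have : A = D * (1 + N) := by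
    simp [N, ← mul_assoc, hDE]
  rw [this]
  exact hD.mul hnil.isUnit_one_add

section NSym

variable (F : Type*) [Field F]

theorem isUnit_tevlinMatrix [CharZero F] (I : Comp) (m : ℕ) :
    IsUnit ((tevlinMatrix F I m).submatrix (Fin.last m).succAbove (0 : Fin (m + 1)).succAbove) := by
  apply isUnit_of_lower
  · intro i j hij
    rw [Fin.lt_def] at hij
    simp only [tevlinMatrix, Matrix.submatrix_apply, Matrix.of_apply, Fin.succAbove_last,
      Fin.succAbove_zero, Fin.val_castSucc, Fin.val_succ]
    rw [if_neg (by omega), if_neg (by omega)]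
  · intro i
    simp only [tevlinMatrix, Matrix.submatrix_apply, Matrix.of_apply, Fin.succAbove_last,
      Fin.succAbove_zero, Fin.val_castSucc, Fin.val_succ]
    rw [if_neg (by omega), if_pos trivial]
    have h : (((i : ℕ) + 1 : ℕ) : F) ≠ 0 := Nat.cast_ne_zero.2 (Nat.succ_ne_zero _)
    have := (IsUnit.mk0 _ h).map (algebraMap F (NSym F))
    rwa [map_natCast] at this

/-- Expansion of the quasideterminant that defines `Ψ_I`. -/
theorem monomialPsi_expand [CharZero F] : ∀ (m : ℕ) (I : Comp), I.length = m + 1 →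
    ((m + 1 : ℕ) : NSym F) * monomialPsi F I = ∑ t ∈ Finset.range (m + 1),
      (-1) ^ t * (powerSum F (Comp.weight (I.take (t + 1))) * monomialPsi F (I.drop (t + 1))) := by
  intro m
  induction m using Nat.strong_induction_on with
  | _ m ih =>
  intro I hI
  have hx : ∀ a : ℕ, a ≤ m → ∀ b ∈ Finset.range (a + 1),
      (-1 : NSym F) ^ a * ((-1) ^ (a - b) *
        (powerSum F (Comp.weight ((I.drop (m - a)).take (a - b + 1))) *
          monomialPsi F ((I.drop (m - a)).drop (a - b + 1)))) =
      powerSum F (Comp.weight ((I.drop (m - a)).take (a + 1 - b))) *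
        ((-1) ^ b * monomialPsi F (I.drop (m + 1 - b))) := by
    intro a ha b hb
    rw [Finset.mem_range] at hb
    rw [List.drop_drop, show m - a + (a - b + 1) = m + 1 - b by omega,
      show a - b + 1 = a + 1 - b by omega, ← mul_assoc, ← pow_add,
      ← mul_assoc (powerSum F _), (Commute.neg_one_right (powerSum F _)).pow_right b, mul_assoc]
    congr 1
    rw [show a + (a - b) = 2 * (a - b) + b by omega, pow_add, pow_mul]
    simp
  have hq := quasidet_eq (tevlinMatrix F I m) (Fin.last m) 0 (isUnit_tevlinMatrix F I m)
    (fun b => (-1) ^ (b : ℕ) * monomialPsi F (I.drop (m + 1 - b)))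
    (by simp [← hI, monomialPsi]) (by
      intro a
      have ha := a.2
      rw [Fin.succAbove_last]
      have h1 := ih a ha (I.drop (m - a)) (by rw [List.length_drop]; omega)
      rw [← Finset.sum_range_reflect] at h1
      have h2 : ∑ j : Fin (m + 1), tevlinMatrix F I m a.castSucc j *
          ((-1) ^ (j : ℕ) * monomialPsi F (I.drop (m + 1 - j))) =
          ∑ b ∈ Finset.range (m + 1), (if b ≤ (a : ℕ) then
              powerSum F (Comp.weight ((I.drop (m - a)).take (a + 1 - b)))
            else if b = a + 1 then ((a + 1 : ℕ) : NSym F) else 0) *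
          ((-1) ^ b * monomialPsi F (I.drop (m + 1 - b))) := by
        rw [Finset.sum_range]
        rfl
      rw [h2, ← Finset.sum_subset (Finset.range_mono (show (a : ℕ) + 1 + 1 ≤ m + 1 by omega))
        (by
          intro b _ hb
          rw [Finset.mem_range] at hb
          rw [if_neg (by omega), if_neg (by omega), zero_mul]), Finset.sum_range_succ,
        if_neg (by omega), if_pos rfl]
      have h3 : ∑ b ∈ Finset.range ((a : ℕ) + 1), (if b ≤ (a : ℕ) then
              powerSum F (Comp.weight ((I.drop (m - a)).take (a + 1 - b)))
            else if b = a + 1 then ((a + 1 : ℕ) : NSym F) else 0) *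
          ((-1) ^ b * monomialPsi F (I.drop (m + 1 - b))) =
          (-1) ^ (a : ℕ) * (((a + 1 : ℕ) : NSym F) * monomialPsi F (I.drop (m - a))) := by
        rw [h1, Finset.mul_sum]
        refine Finset.sum_congr rfl fun b hb => ?_
        have hb' := Finset.mem_range.1 hb
        rw [if_pos (by omega), ← hx a ha.le b hb, show (a : ℕ) + 1 - 1 - b = a - b by omega]
      rw [h3, show m + 1 - ((a : ℕ) + 1) = m - a by omega, pow_succ,
        ← mul_assoc, ← mul_assoc, (Nat.cast_commute (a + 1 : ℕ) _).eq]
      simp)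
  have h4 : ((m + 1 : ℕ) : NSym F) * monomialPsi F I =
      (-1) ^ m * quasidet (tevlinMatrix F I m) (Fin.last m) 0 := by
    cases I with
    | nil => simp at hI
    | cons i I =>
      have hl : I.length = m := by simpa using hI
      subst hl
      have h : ((I.length + 1 : ℕ) : F) ≠ 0 := Nat.cast_ne_zero.2 (Nat.succ_ne_zero _)
      rw [monomialPsi, ← map_natCast (algebraMap F (NSym F)), ← Algebra.smul_def, smul_smul,
        mul_left_comm, mul_inv_cancel₀ h, mul_one, Algebra.smul_def, map_pow, map_neg, map_one]
  rw [h4, hq, ← Finset.sum_range_reflect, Finset.sum_fin_eq_sum_range]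
  rw [Finset.mul_sum]
  refine Finset.sum_congr rfl fun b hb => ?_
  have hb' := Finset.mem_range.1 hb
  have := hx m le_rfl b hb
  rw [dif_pos hb']
  simp only [tevlinMatrix, Matrix.of_apply, Fin.val_last]
  rw [if_pos (by omega), ← this, ← mul_assoc, ← pow_add, ← two_mul, pow_mul]
  simp

theorem monomialPsi_singleton [CharZero F] (k : ℕ+) : monomialPsi F [k] = powerSum F k := by
  have := monomialPsi_expand F 0 [k] rfl
  simpa [Comp.weight, monomialPsi] using this

/-- `Ψ_k Ψ_I = (r + 1) Ψ_{k · I} + r Ψ_{k ▷ I}` for a composition `I` of length `r ≥ 1`. -/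
theorem powerSum_mul_monomialPsi [CharZero F] (k j : ℕ+) (I : Comp) :
    powerSum F k * monomialPsi F (j :: I) =
      ((I.length + 2 : ℕ) : NSym F) * monomialPsi F (k :: j :: I) +
        ((I.length + 1 : ℕ) : NSym F) * monomialPsi F ((k + j) :: I) := by
  rw [monomialPsi_expand F (I.length + 1) (k :: j :: I) rfl,
    monomialPsi_expand F I.length ((k + j) :: I) rfl, Finset.sum_range_succ', add_assoc,
    add_comm (_ * _), ← add_assoc, ← Finset.sum_add_distrib, Finset.sum_eq_zero]
  · simp [Comp.weight]
  · intro t _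
    simp [Comp.weight, pow_succ, add_assoc]

/-- The module with basis the compositions, used as a representation of `NSym`. -/
abbrev CompMod := Comp →₀ F

/-- The action of `Ψ_k` on a basis vector. -/
def psiActBasis (k : ℕ+) : Comp → CompMod F
  | [] => Finsupp.single [k] 1
  | j :: I => Finsupp.single (k :: j :: I) ((I.length + 2 : ℕ) : F) +
      Finsupp.single ((k + j) :: I) ((I.length + 1 : ℕ) : F)

/-- The action of `Ψ_k`. -/
def psiAct (k : ℕ) : Module.End F (CompMod F) :=
  if h : 0 < k then Finsupp.linearCombination F (psiActBasis F (k.toPNat h)) else 0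

/-- The action of `S_n`. -/
def sAct (n : ℕ) : Module.End F (CompMod F) :=
  if n = 0 then 1 else ((n : F)⁻¹) • (psiAct F n + ∑ k : Fin n, if (k : ℕ) = 0 then 0 else
    if _h : n - k < n then sAct (n - k) * psiAct F k else 0)
  termination_by n

/-- The representation of `NSym` on the module of compositions. -/
def compRep : NSym F →ₐ[F] Module.End F (CompMod F) :=
  FreeAlgebra.lift F fun n : ℕ+ => sAct F n

theorem compRep_completeS (n : ℕ) : compRep F (completeS F n) = sAct F n := by
  unfold completeS
  split_ifs with h
  · exact FreeAlgebra.lift_ι_apply _ _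
  · rw [sAct, if_pos (by omega), map_one]

theorem compRep_powerSum [CharZero F] (n : ℕ) : compRep F (powerSum F n) = psiAct F n := by
  induction n using Nat.strong_induction_on with
  | _ n ih =>
  rw [powerSum, map_sub, map_mul, map_natCast, compRep_completeS, map_sum]
  rcases Nat.eq_zero_or_pos n with h0 | h0
  · subst h0; simp [psiAct]
  have hn : (n : F) ≠ 0 := by exact_mod_cast h0.ne'
  have h1 : ((n : ℕ) : Module.End F (CompMod F)) * sAct F n = psiAct F n +
      ∑ k : Fin n, if (k : ℕ) = 0 then 0 else
        if h : n - k < n then sAct F (n - k) * psiAct F k else 0 := by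
    rw [sAct, if_neg h0.ne', ← map_natCast (algebraMap F (Module.End F (CompMod F))),
      ← Algebra.smul_def, smul_smul, mul_inv_cancel₀ hn, one_smul]
  rw [h1, sub_eq_iff_eq_add]
  congr 1
  refine Finset.sum_congr rfl fun k _ => ?_
  split_ifs with h h'
  · simp
  · rw [map_mul, compRep_completeS, ih k k.2]
  · omega

theorem compRep_monomialPsi [CharZero F] : ∀ (m : ℕ) (I : Comp), I.length = m →
    compRep F (monomialPsi F I) (Finsupp.single [] 1) = Finsupp.single I 1 := by
  intro m
  induction m with
  | zero =>
    intro I hI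
    rw [List.length_eq_zero_iff] at hI
    subst hI
    simp [monomialPsi]
  | succ m ih =>
    intro I hI
    match I, hI with
    | [k], _ =>
      rw [monomialPsi_singleton, compRep_powerSum, psiAct, dif_pos k.pos]
      simp [psiActBasis]
      rfl
    | k :: j :: I, hI =>
      have h := congrArg (fun y => compRep F y (Finsupp.single [] 1))
        (powerSum_mul_monomialPsi F k j I)
      simp only [map_mul, map_add, Module.End.mul_apply, LinearMap.add_apply, map_natCast] at h
      rw [ih (j :: I) (by simpa using hI), ih ((k + j) :: I) (by simpa using hI),
        compRep_powerSum, psiAct, dif_pos k.pos] at h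
      have hn : ((I.length + 2 : ℕ) : F) ≠ 0 := Nat.cast_ne_zero.2 (Nat.succ_ne_zero _)
      rw [← map_natCast (algebraMap F (Module.End F (CompMod F))),
        ← map_natCast (algebraMap F (Module.End F (CompMod F))),
        Module.algebraMap_end_apply, Module.algebraMap_end_apply] at h
      simp only [Finsupp.linearCombination_single, one_smul, psiActBasis, Finsupp.smul_single,
        smul_eq_mul, mul_one] at h
      have h' := add_right_cancel h
      have h'' := congrArg (fun y => ((I.length + 2 : ℕ) : F)⁻¹ • y) h'
      simp only [smul_smul, inv_mul_cancel₀ hn, one_smul, Finsupp.smul_single, smul_eq_mul] at h''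
      exact h''.symm

theorem linearIndependent_monomialPsi [CharZero F] : LinearIndependent F (monomialPsi F) := by
  have h : LinearIndependent F
      (((LinearMap.applyₗ (Finsupp.single [] 1 : CompMod F)) ∘ₗ (compRep F).toLinearMap) ∘
        monomialPsi F) := by
    have : (((LinearMap.applyₗ (Finsupp.single [] 1 : CompMod F)) ∘ₗ (compRep F).toLinearMap) ∘
        monomialPsi F) = fun I => (Finsupp.single I 1 : CompMod F) := by
      funext I
      exact compRep_monomialPsi F _ I rfl
    rw [this]
    exact Finsupp.linearIndependent_single_one F Comp
  exact LinearIndependent.of_comp _ h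

theorem span_monomialPsi [CharZero F] : ⊤ ≤ Submodule.span F (Set.range (monomialPsi F)) := by
  set W := Submodule.span F (Set.range (monomialPsi F)) with hW
  have hmem : ∀ I, monomialPsi F I ∈ W := fun I => Submodule.subset_span ⟨I, rfl⟩
  have hnat : ∀ (n : ℕ) (x : NSym F), x ∈ W → (n : NSym F) * x ∈ W := by
    intro n x hx
    rw [← nsmul_eq_mul]
    exact W.nsmul_mem hx n
  have hpos : ∀ k : ℕ+, ∀ x ∈ W, powerSum F k * x ∈ W := by
    intro k x hx
    induction hx using Submodule.span_induction with
    | mem x h =>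
      obtain ⟨I, rfl⟩ := h
      cases I with
      | nil => rw [monomialPsi, mul_one, ← monomialPsi_singleton]; exact hmem _
      | cons j I =>
        rw [powerSum_mul_monomialPsi]
        exact W.add_mem (hnat _ _ (hmem _)) (hnat _ _ (hmem _))
    | zero => rw [mul_zero]; exact W.zero_mem
    | add x y _ _ hx hy => rw [mul_add]; exact W.add_mem hx hy
    | smul a x _ hx => rw [mul_smul_comm]; exact W.smul_mem _ hx
  have hS : ∀ n : ℕ, ∀ x ∈ W, completeS F n * x ∈ W := by
    intro n
    induction n using Nat.strong_induction_on with
    | _ n ih =>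
    intro x hx
    rcases Nat.eq_zero_or_pos n with h0 | h0
    · subst h0; simpa [completeS] using hx
    have hn : (n : F) ≠ 0 := by exact_mod_cast h0.ne'
    have h1 : (n : F) • (completeS F n * x) = powerSum F n * x +
        ∑ k : Fin n, if (k : ℕ) = 0 then 0 else completeS F (n - k) * (powerSum F k * x) := by
      rw [powerSum, sub_mul, Finset.sum_mul, Algebra.smul_def, map_natCast, ← mul_assoc]
      rw [sub_add_eq_add_sub, eq_sub_iff_add_eq]
      congr 1
      refine Finset.sum_congr rfl fun k _ => ?_
      split_ifs <;> simp [mul_assoc]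
    have h2 : (n : F) • (completeS F n * x) ∈ W := by
      rw [h1]
      refine W.add_mem (hpos ⟨n, h0⟩ x hx) (W.sum_mem fun k _ => ?_)
      split_ifs with hk
      · exact W.zero_mem
      · exact ih _ (by omega) _ (hpos ⟨k, by omega⟩ x hx)
    exact (W.smul_mem_iff hn).1 h2
  have hall : ∀ y : NSym F, ∀ x ∈ W, y * x ∈ W := by
    intro y
    induction y using FreeAlgebra.induction with
    | grade0 r => intro x hx; rw [← Algebra.smul_def]; exact W.smul_mem _ hx
    | grade1 n =>
      intro x hx
      have := hS n x hx
      rwa [completeS, dif_pos n.pos] at this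
    | mul a b ha hb => intro x hx; rw [mul_assoc]; exact ha _ (hb _ hx)
    | add a b ha hb => intro x hx; rw [add_mul]; exact W.add_mem (ha _ hx) (hb _ hx)
  intro y _
  have := hall y 1 (hmem [])
  rwa [mul_one] at this

/-- The basis `(Ψ_I)` of `NSym`, indexed by all compositions. -/
def psiBasis [CharZero F] : Module.Basis Comp F (NSym F) :=
  Module.Basis.mk (linearIndependent_monomialPsi F) (span_monomialPsi F)

end NSym

/-! ### Packed words -/

/-- Replace every letter of `w` by its rank (starting at `1`) among the letters of `w`. -/
def pack (w : List ℕ) : List ℕ := w.map fun x => (w.toFinset.filter (· ≤ x)).card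

/-- Packed words. -/
abbrev PackedWord := {w : List ℕ // pack w = w}

theorem finite_packedWord (n : ℕ) : {w : PackedWord | w.1.length = n}.Finite := by
  have hfin : {l : List (Fin (n + 1)) | List.length l = n}.Finite := List.finite_length_eq _ n
  refine Set.Finite.of_finite_image ((hfin.image (List.map fun i : Fin (n + 1) => (i : ℕ))).subset ?_)
    (Subtype.val_injective.injOn)
  rintro _ ⟨⟨w, hw⟩, hn, rfl⟩
  replace hn : w.length = n := hn
  have hle : ∀ x ∈ w, x < n + 1 := by
    intro x hx
    have hx' := hx
    rw [← hw, pack, List.mem_map] at hx'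
    obtain ⟨y, -, rfl⟩ := hx'
    have := (Finset.card_filter_le w.toFinset (· ≤ y)).trans (List.toFinset_card_le w)
    omega
  refine ⟨w.pmap (fun x h => (⟨x, h⟩ : Fin (n + 1))) hle, by simpa using hn, ?_⟩
  simp [List.map_pmap]

/-- The finite set of packed words of length `n`. -/
def packedWords (n : ℕ) : Finset PackedWord := (finite_packedWord n).toFinset

/-- The number of special inversions of `u`: the pairs of positions `i < j` with `u_i > u_j`
such that `u_j` is the rightmost occurrence of its letter in `u`. -/
def sinv (u : List ℕ) : ℕ :=
  (Finset.univ.filter fun p : Fin u.length × Fin u.length =>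
    p.1 < p.2 ∧ u.get p.2 < u.get p.1 ∧ ∀ k, p.2 < k → u.get k ≠ u.get p.2).card

/-- The word composition of a word `w`: the composition of `|w|` whose descent set is given by
the positions of the last occurrences of the letters of `w`. The first letter `a` of `a :: w`
ends a part exactly if it is a last occurrence, that is, if it is not in `w`. -/
def wordComp : List ℕ → Comp
  | [] => []
  | a :: w => if a ∈ w then
      match wordComp w with
      | [] => [1]
      | i :: I => (i + 1) :: I
    else 1 :: wordComp w

/-- The convolution of two packed words: all packed words `z = x · y` with `pack x = u` and
`pack y = v`. -/
def convolution (u v : PackedWord) : Finset PackedWord :=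
  open Classical in
  (packedWords (u.1.length + v.1.length)).filter fun z =>
    ∃ x y : List ℕ, z.1 = x ++ y ∧ pack x = u.1 ∧ pack y = v.1

/-! ### Word quasi-symmetric functions and the `q`-product -/

section WQSym

variable (F : Type*) [Field F]

/-- The space of word quasi-symmetric functions, with basis `M_u` indexed by packed words. -/
abbrev WQSym := PackedWord →₀ F

/-- The basis element `M_u`. -/
def basisM (u : PackedWord) : WQSym F := Finsupp.single u 1

variable {F}

/-- The product of word quasi-symmetric functions, bilinear with
`M_u M_v = ∑_{z ∈ convolution u v} M_z`. -/
def mulM (f g : WQSym F) : WQSym F :=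
  f.sum fun u a => g.sum fun v b => (a * b) • ∑ z ∈ convolution u v, basisM F z

/-- The linear map `φ_q` with `φ_q(M_u) = q^{sinv u} M_u`. -/
def phi (q : F) : WQSym F →ₗ[F] WQSym F :=
  Finsupp.linearCombination F fun u => q ^ sinv u.1 • basisM F u

/-- The product `⋆_q` (`q ≠ 0`): with `M'_u = φ_q(M_u)`, it is the bilinear product with
`M'_u ⋆_q M'_v = φ_q(M_u M_v)`. The inverse of `φ_q` is `φ_{1/q}`. -/
def starQ (q : F) (f g : WQSym F) : WQSym F := phi q (mulM (phi q⁻¹ f) (phi q⁻¹ g))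

theorem phi_inv_phi {q : F} (hq : q ≠ 0) (f : WQSym F) : phi q⁻¹ (phi q f) = f := by
  have : phi q⁻¹ ∘ₗ phi q = LinearMap.id := by
    refine Finsupp.lhom_ext' fun u => LinearMap.ext_ring ?_
    simp [phi, basisM, hq]
  exact LinearMap.congr_fun this f

theorem starQ_phi {q : F} (hq : q ≠ 0) (u v : PackedWord) :
    starQ q (phi q (basisM F u)) (phi q (basisM F v)) =
      phi q (∑ z ∈ convolution u v, basisM F z) := by
  rw [starQ, phi_inv_phi hq, phi_inv_phi hq]
  congr 1
  simp [mulM, basisM]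

variable (F) in
/-- The image of `S_n` under the embedding of `NSym` in `WQSym`: the sum of `M_u` over the packed
words `u` of length `n` with standardization `12⋯n`, that is, the nondecreasing ones. -/
def embedS (n : ℕ) : WQSym F :=
  open Classical in
  ∑ u ∈ (packedWords n).filter (fun u => u.1.Pairwise (· ≤ ·)), basisM F u

/-- The product `embedS j_1 ⋆_q (embedS j_2 ⋆_q (⋯ ⋆_q embedS j_l))`; the empty product is the
unit `M_∅`. The product `⋆_q` is associative with unit `M_∅`. -/
def starProd (q : F) : Comp → WQSym F
  | [] => basisM F ⟨[], rfl⟩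
  | j :: J => starQ q (embedS F j) (starProd q J)

variable (F) in
/-- The linear map `ζ` with `ζ(M_u) = Ψ_{WC(u)}`. -/
def zeta : WQSym F →ₗ[F] NSym F :=
  Finsupp.linearCombination F fun u => monomialPsi F (wordComp u.1)

/-- The noncommutative Hall–Littlewood function `S^J(q)`. -/
def hallS (q : F) (J : Comp) : NSym F := zeta F (starProd q J)

/-- The coefficient `C_I^J(q)` of `Ψ_I` in `S^J(q)`. -/
def coeffC [CharZero F] (q : F) (I J : Comp) : F := (psiBasis F).repr (hallS q J) I

/-- The `q`-binomial coefficient, through the `q`-Pascal rule. -/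
def qBinom {R : Type*} [CommSemiring R] (q : R) : ℕ → ℕ → R
  | _, 0 => 1
  | 0, _ + 1 => 0
  | n + 1, k + 1 => qBinom q n k + q ^ (k + 1) * qBinom q n (k + 1)

end WQSym

end TevlinHL

end

open TevlinHL

/-!
The map `φ_q` fixes each `S̃_j`, so `S̃_{j_1} ⋆_q ⋯ ⋆_q S̃_{j_l}` is `φ_q` of the undeformed product,
which is the sum of `M_z` over the packed words `z` that are nondecreasing on the consecutive blocks
of lengths `j_1, …, j_l` (`starProd_eq`). Hence `C_I^J(q)` is the sum of `q ^ sinv z` over those `z`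
with `WC z = I` (`coeffC_eq_sum_words`).

These words are encoded from right to left: `wordCode z` records, for each letter, its rank `c_p`
among the distinct letters to its right.

* The sum of the code is `sinv z` (`sinv_eq_sum_wordCode`).
* The packed words `z` with `WC z = I` correspond bijectively to the sequences `c` of length `|I|`
  such that `c_p` is less than the number of parts of `I` left after the cells before `p` are
  removed (`codeBound_wordCode`, `packedWord_eq_of_wordCode_eq`, `exists_packedWord`).
* Adjacent letters of `z` are weakly increasing exactly if the corresponding entries of the code are
  (`letterRank_le_letterRank_iff`), so `z` is nondecreasing on the blocks of `J` exactly if its code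
  is.

The bounds on `c_p` decrease weakly with `p`, so in a block on which `c` is nondecreasing only the
bound at the last position matters. The blocks are therefore independent, and a block of length `j`
with last bound `k` contributes `h_j(1, q, …, q^{k-1})`, the `q`-binomial coefficient of `k + j - 1`
over `j` (`sum_sortedWords`). This gives the recursion `coeffC_cons`, valid for all `I` and `J` of
the same weight; both rules of the theorem are instances of it. If `i_1 ≥ j_1`, the last position of
the first block is in the first row of `I`, and `k` is the length of `I`; if `i_1 < j_1`, nothing in
the recursion changes when the first two rows are merged (`removeCells_merge`).
-/

namespace TevlinHL

/-! ### Ranks, packing and codes of words -/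

/-- The number of distinct letters of `w` that are smaller than `a`. -/
def letterRank (w : List ℕ) (a : ℕ) : ℕ := (w.toFinset.filter (· < a)).card

/-- The code of a word: each letter is replaced by its rank among the distinct letters to its
right. -/
def wordCode : List ℕ → List ℕ
  | [] => []
  | a :: w => letterRank w a :: wordCode w

theorem letterRank_mono (w : List ℕ) : Monotone (letterRank w) := fun _ _ h =>
  Finset.card_le_card (Finset.monotone_filter_right _ fun _ _ hx => lt_of_lt_of_le hx h)

theorem letterRank_lt_iff {w : List ℕ} {x : ℕ} (hx : x ∈ w) (a : ℕ) :
    letterRank w x < letterRank w a ↔ x < a := by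
  refine ⟨fun h => lt_of_not_ge fun h' => absurd (letterRank_mono w h') (by omega), fun h => ?_⟩
  refine Finset.card_lt_card (Finset.ssubset_iff_of_subset
    (Finset.monotone_filter_right _ fun _ _ hy => lt_trans hy h) |>.2 ⟨x, ?_, ?_⟩)
  · simp [hx, h]
  · simp

theorem letterRank_map {w : List ℕ} {a : ℕ} {f : ℕ → ℕ}
    (hf : StrictMonoOn f {x | x ∈ a :: w}) : letterRank (w.map f) (f a) = letterRank w a := by
  have hw : ∀ x ∈ w, x ∈ {x | x ∈ a :: w} := fun x hx => List.mem_cons_of_mem _ hx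
  have : (w.map f).toFinset.filter (· < f a) = (w.toFinset.filter (· < a)).image f := by
    ext y
    simp only [Finset.mem_filter, List.mem_toFinset, List.mem_map, Finset.mem_image]
    constructor
    · rintro ⟨⟨x, hx, rfl⟩, h⟩
      exact ⟨x, ⟨hx, (hf.lt_iff_lt (hw x hx) List.mem_cons_self).1 h⟩, rfl⟩
    · rintro ⟨x, ⟨hx, h⟩, rfl⟩
      exact ⟨⟨x, hx, rfl⟩, (hf.lt_iff_lt (hw x hx) List.mem_cons_self).2 h⟩
  rw [letterRank, this, Finset.card_image_of_injOn, letterRank]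
  intro x hx y hy h
  simp only [Finset.coe_filter, List.mem_toFinset, Set.mem_ofPred_eq] at hx hy
  exact hf.injOn (hw x hx.1) (hw y hy.1) h

theorem pack_strictMonoOn (w : List ℕ) :
    StrictMonoOn (fun x => (w.toFinset.filter (· ≤ x)).card) {x | x ∈ w} := by
  intro x _ y hy h
  refine Finset.card_lt_card (Finset.ssubset_iff_of_subset
    (Finset.monotone_filter_right _ fun _ _ hz => le_trans hz h.le) |>.2 ⟨y, ?_, ?_⟩)
  · simpa using hy
  · simp [h]

theorem pack_map {w : List ℕ} {f : ℕ → ℕ} (hf : StrictMonoOn f {x | x ∈ w}) :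
    pack (w.map f) = pack w := by
  rw [pack, List.map_map, pack]
  refine List.map_congr_left fun a ha => ?_
  have : (w.map f).toFinset.filter (· ≤ f a) = (w.toFinset.filter (· ≤ a)).image f := by
    ext y
    simp only [Finset.mem_filter, List.mem_toFinset, List.mem_map, Finset.mem_image]
    constructor
    · rintro ⟨⟨x, hx, rfl⟩, h⟩
      exact ⟨x, ⟨hx, (hf.le_iff_le hx ha).1 h⟩, rfl⟩
    · rintro ⟨x, ⟨hx, h⟩, rfl⟩
      exact ⟨⟨x, hx, rfl⟩, (hf.le_iff_le hx ha).2 h⟩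
  rw [Function.comp_apply, this, Finset.card_image_of_injOn]
  intro x hx y hy h
  simp only [Finset.coe_filter, List.mem_toFinset, Set.mem_ofPred_eq] at hx hy
  exact hf.injOn hx.1 hy.1 h

theorem pack_pack (w : List ℕ) : pack (pack w) = pack w := pack_map (pack_strictMonoOn w)

/-- The packed word of a word. -/
def packWord (w : List ℕ) : PackedWord := ⟨pack w, pack_pack w⟩

@[simp]
theorem length_pack (w : List ℕ) : (pack w).length = w.length := by simp [pack]

@[simp]
theorem length_wordCode (w : List ℕ) : (wordCode w).length = w.length := by
  induction w with
  | nil => rfl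
  | cons a w ih => simp [wordCode, ih]

theorem wordCode_drop (n : ℕ) (w : List ℕ) : wordCode (w.drop n) = (wordCode w).drop n := by
  induction w generalizing n with
  | nil => simp [wordCode]
  | cons a w ih => cases n <;> simp [wordCode, ih]

theorem wordCode_map {w : List ℕ} {f : ℕ → ℕ} (hf : StrictMonoOn f {x | x ∈ w}) :
    wordCode (w.map f) = wordCode w := by
  induction w with
  | nil => rfl
  | cons a w ih =>
    rw [List.map_cons, wordCode, wordCode, letterRank_map hf,
      ih (hf.mono fun x hx => List.mem_cons_of_mem _ hx)]

theorem wordComp_map {w : List ℕ} {f : ℕ → ℕ} (hf : StrictMonoOn f {x | x ∈ w}) :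
    wordComp (w.map f) = wordComp w := by
  induction w with
  | nil => rfl
  | cons a w ih =>
    have : f a ∈ w.map f ↔ a ∈ w := by
      refine ⟨fun h => ?_, List.mem_map_of_mem⟩
      obtain ⟨x, hx, h⟩ := List.mem_map.1 h
      rwa [← hf.injOn (List.mem_cons_of_mem _ hx) List.mem_cons_self h]
    simp only [List.map_cons, wordComp, this, ih (hf.mono fun x hx => List.mem_cons_of_mem _ hx)]

/-- The code compares adjacent letters in the same way as the word: a letter exceeds the next one
exactly if its rank does, whether or not it recurs to its right. -/
theorem letterRank_le_letterRank_iff (a b : ℕ) (w : List ℕ) :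
    letterRank (b :: w) a ≤ letterRank w b ↔ a ≤ b := by
  have h : letterRank w b = letterRank (b :: w) b := by
    simp [letterRank, Finset.filter_insert]
  rw [h, ← not_lt, letterRank_lt_iff List.mem_cons_self, not_lt]

theorem isChain_take_wordCode (n : ℕ) (w : List ℕ) :
    ((wordCode w).take n).IsChain (· ≤ ·) ↔ (w.take n).IsChain (· ≤ ·) := by
  induction w generalizing n with
  | nil => simp [wordCode]
  | cons a w ih =>
    match n, w with
    | 0, _ => simp
    | 1, _ => simp [wordCode]
    | n + 2, [] => simp [wordCode]
    | n + 2, b :: w =>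
      have := ih (n + 1)
      simp only [wordCode, List.take_succ_cons, List.isChain_cons_cons] at this ⊢
      rw [this, letterRank_le_letterRank_iff]

/-! ### The word composition -/

theorem weight_cons (i : ℕ+) (I : Comp) : Comp.weight (i :: I) = i + Comp.weight I := by
  simp [Comp.weight]

theorem wordComp_ne_nil {w : List ℕ} (hw : w ≠ []) : wordComp w ≠ [] := by
  cases w with
  | nil => exact absurd rfl hw
  | cons a w =>
    rw [wordComp]
    split_ifs
    · split <;> simp
    · simp

theorem removeCells_one_cons (I : Comp) : removeCells 1 (1 :: I) = I := by
  cases I with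
  | nil => simp [removeCells]
  | cons i I =>
    have h := i.pos
    simp only [removeCells]
    simp [h]
    rfl

theorem removeCells_one_add (i : ℕ+) (I : Comp) : removeCells 1 ((i + 1) :: I) = i :: I := by
  have h := i.pos
  simp only [removeCells]
  rw [dif_pos (by simp)]
  congr 1

theorem wordComp_cons_of_mem {a : ℕ} {w : List ℕ} (h : a ∈ w) :
    ∃ i I, wordComp w = i :: I ∧ wordComp (a :: w) = (i + 1) :: I := by
  rcases hw : wordComp w with _ | ⟨i, I⟩
  · exact absurd hw (wordComp_ne_nil (List.ne_nil_of_mem h))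
  · exact ⟨i, I, rfl, by simp [wordComp, h, hw]⟩

theorem wordComp_cons_of_notMem {a : ℕ} {w : List ℕ} (h : a ∉ w) :
    wordComp (a :: w) = 1 :: wordComp w := by
  simp [wordComp, h]

theorem removeCells_one_wordComp (a : ℕ) (w : List ℕ) :
    removeCells 1 (wordComp (a :: w)) = wordComp w := by
  by_cases h : a ∈ w
  · obtain ⟨i, I, h1, h2⟩ := wordComp_cons_of_mem h
    rw [h1, h2, removeCells_one_add]
  · rw [wordComp_cons_of_notMem h, removeCells_one_cons]

theorem length_wordComp (w : List ℕ) : (wordComp w).length = w.toFinset.card := by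
  induction w with
  | nil => rfl
  | cons a w ih =>
    by_cases h : a ∈ w
    · obtain ⟨i, I, h1, h2⟩ := wordComp_cons_of_mem h
      rw [h2, List.toFinset_cons, Finset.insert_eq_of_mem (by simpa using h), ← ih, h1]
      rfl
    · rw [wordComp_cons_of_notMem h, List.toFinset_cons,
        Finset.card_insert_of_notMem (by simpa using h), ← ih]
      rfl

theorem weight_wordComp (w : List ℕ) : Comp.weight (wordComp w) = w.length := by
  induction w with
  | nil => rfl
  | cons a w ih =>
    by_cases h : a ∈ w
    · obtain ⟨i, I, h1, h2⟩ := wordComp_cons_of_mem h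
      rw [h1] at ih
      rw [h2, List.length_cons, ← ih]
      simp [Comp.weight]
      omega
    · rw [wordComp_cons_of_notMem h, List.length_cons, ← ih]
      simp [Comp.weight]
      omega

/-! ### Special inversions -/

/-- The special inversions whose larger letter is the first letter `a` correspond to the letters
below `a` in the rest, each represented by its last occurrence. -/
theorem sinv_cons (a : ℕ) (w : List ℕ) : sinv (a :: w) = letterRank w a + sinv w := by
  have hlast : ∑ j : Fin w.length, (if w.get j < a ∧ ∀ k, j < k → w.get k ≠ w.get j then 1 else 0)
      = letterRank w a := by
    rw [← Finset.card_filter, letterRank]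
    refine Finset.card_nbij w.get (fun j hj => ?_) (fun i hi j hj h => ?_) fun x hx => ?_
    · simp only [Finset.coe_filter, Finset.mem_univ, true_and, Set.mem_ofPred_eq] at hj
      simpa using hj.1
    · simp only [Finset.coe_filter, Finset.mem_univ, true_and, Set.mem_ofPred_eq] at hi hj
      rcases lt_trichotomy i j with h' | h' | h'
      · exact absurd h.symm (hi.2 j h')
      · exact h'
      · exact absurd h (hj.2 i h')
    · simp only [Finset.coe_filter, List.mem_toFinset, Set.mem_ofPred_eq] at hx
      obtain ⟨i, hi⟩ := List.mem_iff_get.1 hx.1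
      obtain ⟨j, hj, hmax⟩ := (Finset.univ.filter fun j => w.get j = x).exists_max_image id
        ⟨i, by simpa using hi⟩
      simp only [Finset.mem_filter, Finset.mem_univ, true_and, id] at hj hmax
      refine ⟨j, ?_, hj⟩
      simp only [Finset.coe_filter, Finset.mem_univ, true_and, Set.mem_ofPred_eq]
      exact ⟨hj ▸ hx.2, fun k hk h => absurd (hmax k (h.trans hj)) (not_le.2 hk)⟩
  rw [← hlast, sinv, sinv, Finset.card_filter, Finset.card_filter, Fintype.sum_prod_type,
    Fintype.sum_prod_type]
  simp only [List.length_cons, Fin.sum_univ_succ, List.get_cons_zero, List.get_cons_succ',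
    Fin.forall_fin_succ, Fin.succ_lt_succ_iff, Fin.not_lt_zero, Fin.succ_pos, false_and,
    if_false, zero_add, true_and, false_imp_iff]

theorem sinv_eq_sum_wordCode (w : List ℕ) : sinv w = (wordCode w).sum := by
  induction w with
  | nil => rfl
  | cons a w ih => rw [sinv_cons, wordCode, List.sum_cons, ih]

/-! ### Packed words and their codes -/

/-- The codes of the words with word composition `I`: the entry in position `p` is smaller than
the number of parts of `I` that are left when the cells before `p` are removed. -/
def CodeBound : Comp → List ℕ → Prop
  | _, [] => True
  | I, a :: c => a < I.length ∧ CodeBound (removeCells 1 I) c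

theorem codeBound_wordCode (w : List ℕ) : CodeBound (wordComp w) (wordCode w) := by
  induction w with
  | nil => trivial
  | cons a w ih =>
    rw [wordCode, CodeBound, removeCells_one_wordComp]
    refine ⟨?_, ih⟩
    rw [length_wordComp]
    refine Finset.card_lt_card (Finset.ssubset_iff_of_subset ?_ |>.2 ⟨a, ?_, ?_⟩)
    · exact (Finset.filter_subset _ _).trans (by simp)
    · simp
    · simp

/-- Two words with the same word composition and the same code are order isomorphic. -/
theorem exists_strictMonoOn_of_wordCode_eq (w w' : List ℕ) (hI : wordComp w = wordComp w')
    (hc : wordCode w = wordCode w') :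
    ∃ f : ℕ → ℕ, StrictMonoOn f {x | x ∈ w} ∧ w' = w.map f := by
  induction w generalizing w' with
  | nil =>
    have := congrArg List.length hc
    rw [length_wordCode, length_wordCode, List.length_nil, eq_comm,
      List.length_eq_zero_iff] at this
    exact ⟨id, strictMonoOn_id, by simp [this]⟩
  | cons a w ih =>
    cases w' with
    | nil => simp [wordCode] at hc
    | cons a' w' =>
      have hI' : wordComp w = wordComp w' := by
        rw [← removeCells_one_wordComp a w, hI, removeCells_one_wordComp]
      rw [wordCode, wordCode, List.cons.injEq] at hc
      obtain ⟨f, hf, rfl⟩ := ih w' hI' hc.2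
      have hmem : a ∈ w ↔ a' ∈ w.map f := by
        have h := congrArg List.length hI
        by_cases h1 : a ∈ w <;> by_cases h2 : a' ∈ w.map f <;>
          simp only [h1, h2, iff_true, not_true, iff_false]
        · obtain ⟨i, I, e1, e2⟩ := wordComp_cons_of_mem h1
          rw [wordComp_cons_of_notMem h2, e2, ← hI', e1] at h
          simp at h
        · obtain ⟨i, I, e1, e2⟩ := wordComp_cons_of_mem h2
          rw [wordComp_cons_of_notMem h1, e2, hI', e1] at h
          simp at h
      -- the letters of `w` below `a` correspond to those of the other word below `a'`
      have key : ∀ x ∈ w, x < a ↔ f x < a' := by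
        intro x hx
        rw [← letterRank_lt_iff hx, hc.1, ← letterRank_lt_iff (List.mem_map_of_mem (f := f) hx),
          letterRank_map (f := f) (hf.mono fun y hy => ?_)]
        rcases List.mem_cons.1 hy with rfl | hy
        · exact hx
        · exact hy
      by_cases ha : a ∈ w
      · obtain ⟨b, hb, rfl⟩ := List.mem_map.1 (hmem.1 ha)
        have : a = b := by
          have h1 := key a ha
          have h2 := key b hb
          rw [hf.lt_iff_lt ha hb] at h1
          simp only [lt_irrefl, false_iff, iff_false] at h1 h2
          omega
        subst this
        refine ⟨f, hf.mono fun y hy => ?_, rfl⟩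
        rcases List.mem_cons.1 hy with rfl | hy
        · exact ha
        · exact hy
      · have ha' : a' ∉ w.map f := fun h => ha (hmem.2 h)
        have hu : ∀ x ∈ w, Function.update f a a' x = f x := fun x hx =>
          Function.update_of_ne (ne_of_mem_of_not_mem hx ha) _ _
        refine ⟨Function.update f a a', ?_, ?_⟩
        · intro x hx y hy hxy
          rcases List.mem_cons.1 hx with rfl | hx <;> rcases List.mem_cons.1 hy with rfl | hy
          · exact absurd hxy (lt_irrefl _)
          · rw [hu y hy, Function.update_self]
            refine lt_of_le_of_ne (not_lt.1 fun h => ?_)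
              fun h => ha' (h ▸ List.mem_map_of_mem hy)
            exact absurd ((key y hy).2 h) hxy.not_gt
          · rw [hu x (by assumption), Function.update_self]
            exact (key x (by assumption)).1 hxy
          · rw [hu x hx, hu y hy]
            exact hf hx hy hxy
        · rw [List.map_cons, Function.update_self, List.map_congr_left hu]

theorem packedWord_eq_of_wordCode_eq {u v : PackedWord} (hI : wordComp u.1 = wordComp v.1)
    (hc : wordCode u.1 = wordCode v.1) : u = v := by
  obtain ⟨f, hf, h⟩ := exists_strictMonoOn_of_wordCode_eq _ _ hI hc
  refine Subtype.ext ?_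
  rw [← u.2, ← v.2, h, pack_map hf]

theorem pos_of_mem_pack {w : List ℕ} {x : ℕ} (hx : x ∈ pack w) : 1 ≤ x := by
  obtain ⟨y, hy, rfl⟩ := List.mem_map.1 hx
  exact Finset.card_pos.2 ⟨y, by simpa using hy⟩

theorem toFinset_pack (w : List ℕ) : (pack w).toFinset = Finset.Icc 1 w.toFinset.card := by
  refine Finset.eq_of_subset_of_card_le (fun x hx => ?_) ?_
  · rw [List.mem_toFinset] at hx
    refine Finset.mem_Icc.2 ⟨pos_of_mem_pack hx, ?_⟩
    obtain ⟨y, hy, rfl⟩ := List.mem_map.1 hx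
    exact Finset.card_filter_le _ _
  · rw [Nat.card_Icc, add_tsub_cancel_right, ← length_wordComp, ← length_wordComp, pack,
      wordComp_map (pack_strictMonoOn w)]

theorem exists_packedWord_of_word (w : List ℕ) :
    ∃ u : PackedWord, wordComp u.1 = wordComp w ∧ wordCode u.1 = wordCode w :=
  ⟨packWord w, wordComp_map (pack_strictMonoOn w), wordCode_map (pack_strictMonoOn w)⟩

/-- Every sequence within the bounds given by `I` is the code of a packed word with word
composition `I`. The word is built from right to left; the first part of `I` tells whether the
next letter is new (first part `1`) or already occurs. -/
theorem exists_packedWord (I : Comp) (c : List ℕ) (hl : c.length = Comp.weight I)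
    (hb : CodeBound I c) : ∃ u : PackedWord, wordComp u.1 = I ∧ wordCode u.1 = c := by
  induction c generalizing I with
  | nil =>
    refine ⟨⟨[], rfl⟩, ?_, rfl⟩
    cases I with
    | nil => rfl
    | cons i I =>
      have := i.pos
      simp only [Comp.weight, List.length_nil, List.map_cons, List.sum_cons] at hl
      omega
  | cons a c ih =>
    have hrank : ∀ u : PackedWord, a ≤ u.1.toFinset.card →
        (u.1.toFinset.filter (· ≤ a)).card = a := by
      intro u ha
      have h : u.1.toFinset.filter (· ≤ a) = Finset.Icc 1 a := by
        rw [← u.2, toFinset_pack]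
        ext x
        simp only [Finset.mem_filter, Finset.mem_Icc]
        omega
      rw [h, Nat.card_Icc, add_tsub_cancel_right]
    rcases I with _ | ⟨i, I⟩
    · simp [Comp.weight] at hl
    obtain ⟨ha, hb⟩ := hb
    by_cases hi : i = 1
    · -- a new letter: double the letters of the rest, so that all odd numbers are available
      subst hi
      rw [removeCells_one_cons] at hb
      obtain ⟨u, rfl, rfl⟩ := ih I (by simp [Comp.weight] at hl ⊢; omega) hb
      rw [List.length_cons, length_wordComp] at ha
      have hf : StrictMonoOn (fun x : ℕ => 2 * x) {x | x ∈ u.1} := fun x _ y _ h => by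
        simp only; omega
      obtain ⟨v, h1, h2⟩ := exists_packedWord_of_word ((2 * a + 1) :: u.1.map fun x => 2 * x)
      refine ⟨v, ?_, ?_⟩
      · rw [h1, wordComp_cons_of_notMem, wordComp_map hf]
        simp only [List.mem_map, not_exists, not_and]
        omega
      · rw [h2, wordCode, wordCode_map hf]
        congr 1
        refine Eq.trans ?_ (hrank u (by omega))
        rw [letterRank, ← Finset.card_image_of_injective (u.1.toFinset.filter (· ≤ a))
          (f := fun x : ℕ => 2 * x)
          (fun x y h => by simpa using h)]
        congr 1
        ext y
        simp only [Finset.mem_filter, List.mem_toFinset, List.mem_map, Finset.mem_image]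
        constructor
        · rintro ⟨⟨x, hx, rfl⟩, h⟩
          exact ⟨x, ⟨hx, by omega⟩, rfl⟩
        · rintro ⟨x, ⟨hx, h⟩, rfl⟩
          exact ⟨⟨x, hx, rfl⟩, by omega⟩
    · obtain ⟨j, rfl⟩ : ∃ j, i = j + 1 := ⟨i - 1, (PNat.sub_add_of_lt
        (lt_of_le_of_ne one_le (Ne.symm hi))).symm⟩
      rw [removeCells_one_add] at hb
      obtain ⟨u, hu, rfl⟩ := ih (j :: I) (by simp [Comp.weight] at hl ⊢; omega) hb
      have ha' : a < u.1.toFinset.card := by rwa [← length_wordComp, hu]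
      have hmem : a + 1 ∈ u.1 := by
        rw [← List.mem_toFinset, ← u.2, toFinset_pack, Finset.mem_Icc]
        omega
      obtain ⟨v, h1, h2⟩ := exists_packedWord_of_word ((a + 1) :: u.1)
      refine ⟨v, ?_, ?_⟩
      · obtain ⟨i', I', e1, e2⟩ := wordComp_cons_of_mem hmem
        rw [hu] at e1
        obtain ⟨rfl, rfl⟩ := List.cons.inj e1
        rw [h1, e2]
      · rw [h2, wordCode]
        congr 1
        simp only [letterRank, Nat.lt_succ_iff]
        exact hrank u ha'.le

/-! ### Words that are nondecreasing on the blocks of a composition -/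

/-- The word is nondecreasing on each of its consecutive blocks of lengths `j₁, j₂, …`. -/
def BlockSorted : Comp → List ℕ → Prop
  | [], _ => True
  | j :: J, w => (w.take j).Pairwise (· ≤ ·) ∧ BlockSorted J (w.drop j)

theorem blockSorted_wordCode (J : Comp) (w : List ℕ) :
    BlockSorted J (wordCode w) ↔ BlockSorted J w := by
  induction J generalizing w with
  | nil => rfl
  | cons j J ih =>
    rw [BlockSorted, BlockSorted, ← wordCode_drop, ih, ← List.isChain_iff_pairwise,
      ← List.isChain_iff_pairwise, isChain_take_wordCode]

theorem blockSorted_pack (J : Comp) (w : List ℕ) : BlockSorted J (pack w) ↔ BlockSorted J w := by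
  rw [← blockSorted_wordCode, ← blockSorted_wordCode J w, pack,
    wordCode_map (pack_strictMonoOn w)]

theorem pairwise_le_pack (w : List ℕ) :
    (pack w).Pairwise (· ≤ ·) ↔ w.Pairwise (· ≤ ·) := by
  have h : ∀ v : List ℕ, v.Pairwise (· ≤ ·) ↔ (wordCode v).Pairwise (· ≤ ·) := fun v => by
    have := isChain_take_wordCode v.length v
    rw [List.take_length, List.take_of_length_le (by simp)] at this
    rw [← List.isChain_iff_pairwise, ← List.isChain_iff_pairwise, this]
  rw [h, h w, pack, wordCode_map (pack_strictMonoOn w)]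

open Classical in
/-- The packed words of length `|J|` that are nondecreasing on the blocks of `J`. -/
noncomputable def blockSortedWords (J : Comp) : Finset PackedWord :=
  (packedWords (Comp.weight J)).filter fun z => BlockSorted J z.1

theorem mem_packedWords {n : ℕ} {u : PackedWord} : u ∈ packedWords n ↔ u.1.length = n := by
  simp [packedWords]

theorem mem_blockSortedWords {J : Comp} {z : PackedWord} :
    z ∈ blockSortedWords J ↔ z.1.length = Comp.weight J ∧ BlockSorted J z.1 := by
  classical
  rw [blockSortedWords, Finset.mem_filter, mem_packedWords]

/-- A word in the convolution of `u` and `v` can only be cut after `|u|` letters. -/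
theorem mem_convolution {u v z : PackedWord} :
    z ∈ convolution u v ↔ packWord (z.1.take u.1.length) = u ∧
      packWord (z.1.drop u.1.length) = v := by
  classical
  rw [convolution, Finset.mem_filter, mem_packedWords]
  constructor
  · rintro ⟨-, x, y, hz, hx, hy⟩
    have hl : u.1.length = x.length := by rw [← hx, length_pack]
    rw [hz, hl, List.take_left, List.drop_left]
    exact ⟨Subtype.ext hx, Subtype.ext hy⟩
  · rintro ⟨hu, hv⟩
    have hu' := congrArg Subtype.val hu
    have hv' := congrArg Subtype.val hv
    refine ⟨?_, _, _, (List.take_append_drop u.1.length z.1).symm, hu', hv'⟩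
    have h1 := congrArg List.length hu'
    have h2 := congrArg List.length hv'
    simp only [packWord, length_pack, List.length_take, List.length_drop] at h1 h2
    omega

section WQSym

variable {F : Type*} [Field F]

theorem mulM_sum_basisM (A B : Finset PackedWord) :
    mulM (∑ u ∈ A, basisM F u) (∑ v ∈ B, basisM F v) =
      ∑ u ∈ A, ∑ v ∈ B, ∑ z ∈ convolution u v, basisM F z := by
  have key : ∀ (S : Finset PackedWord) (h : PackedWord → F → WQSym F),
      (∀ u, h u 0 = 0) → (∀ u a b, h u (a + b) = h u a + h u b) →
      (∑ u ∈ S, basisM F u).sum h = ∑ u ∈ S, h u 1 := by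
    intro S h h0 hadd
    rw [← Finsupp.sum_finsetSum_index h0 hadd]
    exact Finset.sum_congr rfl fun u _ => Finsupp.sum_single_index (h0 u)
  rw [mulM, key]
  · refine Finset.sum_congr rfl fun u _ => ?_
    rw [key]
    · simp
    · simp
    · intro v a b
      rw [mul_add, add_smul]
  · simp
  · intro u a b
    rw [← Finsupp.sum_add]
    simp only [add_mul, add_smul]

/-- The undeformed product `S̃_j f`, for `f` the sum of the words that are nondecreasing on the
blocks of `J`, is the corresponding sum for `j, J`: a packed word arises exactly once, from the
packings of its first `j` letters and of the other ones. -/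
theorem mulM_embedS_blockSorted (j : ℕ+) (J : Comp) :
    mulM (embedS F j) (∑ v ∈ blockSortedWords J, basisM F v) =
      ∑ z ∈ blockSortedWords (j :: J), basisM F z := by
  classical
  rw [embedS, mulM_sum_basisM, ← Finset.sum_product']
  rw [← Finset.sum_fiberwise_of_maps_to
    (g := fun z : PackedWord => (packWord (z.1.take j), packWord (z.1.drop j)))]
  · refine Finset.sum_congr rfl fun p hp => Finset.sum_congr ?_ fun _ _ => rfl
    obtain ⟨u, v⟩ := p
    obtain ⟨hu, hv⟩ := Finset.mem_product.1 hp
    rw [Finset.mem_filter, mem_packedWords] at hu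
    rw [mem_blockSortedWords] at hv
    ext z
    rw [mem_convolution, Finset.mem_filter, mem_blockSortedWords, Prod.mk.injEq, hu.1]
    refine ⟨fun h => ⟨?_, h⟩, fun h => h.2⟩
    have h1 := congrArg Subtype.val h.1
    have h2 := congrArg Subtype.val h.2
    simp only [packWord] at h1 h2
    constructor
    · have l1 := congrArg List.length h1
      have l2 := congrArg List.length h2
      simp only [length_pack, List.length_take, List.length_drop, hu.1, hv.1] at l1 l2
      rw [weight_cons]
      omega
    · exact ⟨(pairwise_le_pack _).1 (h1 ▸ hu.2), (blockSorted_pack _ _).1 (h2 ▸ hv.2)⟩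
  · intro z hz
    obtain ⟨hl, hs⟩ := mem_blockSortedWords.1 hz
    rw [weight_cons] at hl
    rw [Finset.mem_product, Finset.mem_filter, mem_packedWords, mem_blockSortedWords]
    simp only [packWord, length_pack, List.length_take, List.length_drop]
    exact ⟨⟨by omega, (pairwise_le_pack _).2 hs.1⟩, by omega, (blockSorted_pack _ _).2 hs.2⟩

theorem phi_basisM (q : F) (u : PackedWord) : phi q (basisM F u) = q ^ sinv u.1 • basisM F u := by
  simp [phi, basisM]

theorem sinv_eq_zero_of_pairwise {w : List ℕ} (hw : w.Pairwise (· ≤ ·)) : sinv w = 0 := by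
  rw [sinv, Finset.card_eq_zero, Finset.filter_eq_empty_iff]
  rintro ⟨i, j⟩ - ⟨h1, h2, -⟩
  exact absurd (List.pairwise_iff_get.1 hw i j h1) (not_le.2 h2)

theorem phi_embedS (q : F) (n : ℕ) : phi q (embedS F n) = embedS F n := by
  rw [embedS, map_sum]
  refine Finset.sum_congr rfl fun u hu => ?_
  rw [phi_basisM, sinv_eq_zero_of_pairwise (Finset.mem_filter.1 hu).2, pow_zero, one_smul]

/-- The `φ_q`-preimage of `S̃_{j_1} ⋆_q ⋯ ⋆_q S̃_{j_l}` is the undeformed product of the `S̃_j`, since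
`φ_q` fixes each `S̃_j`; hence it is multiplicity free. -/
theorem starProd_eq {q : F} (hq : q ≠ 0) (J : Comp) :
    starProd q J = phi q (∑ z ∈ blockSortedWords J, basisM F z) := by
  induction J with
  | nil =>
    have h : blockSortedWords [] = {⟨[], rfl⟩} := by
      ext z
      rw [mem_blockSortedWords, Finset.mem_singleton, Subtype.ext_iff]
      simp [Comp.weight, BlockSorted]
    rw [h, Finset.sum_singleton, phi_basisM, starProd]
    simp [sinv]
  | cons j J ih =>
    rw [starProd, ih, starQ, phi_inv_phi hq, phi_embedS, mulM_embedS_blockSorted]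

open Classical in
theorem coeffC_eq_sum_words [CharZero F] {q : F} (hq : q ≠ 0) (I J : Comp) :
    coeffC q I J =
      ∑ z ∈ (blockSortedWords J).filter (fun z => wordComp z.1 = I), q ^ sinv z.1 := by
  rw [coeffC, hallS, starProd_eq hq, map_sum, map_sum, map_sum, Finsupp.finsetSum_apply,
    Finset.sum_filter]
  refine Finset.sum_congr rfl fun z _ => ?_
  have h1 : zeta F (phi q (basisM F z)) = q ^ sinv z.1 • psiBasis F (wordComp z.1) := by
    rw [phi_basisM, map_smul]
    simp [zeta, basisM, psiBasis]
  rw [h1, map_smul, Module.Basis.repr_self, Finsupp.smul_apply, Finsupp.single_apply]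
  split_ifs <;> simp

end WQSym

/-! ### Nondecreasing words and `q`-binomial coefficients -/

/-- The nondecreasing words of length `j` over `{0, …, k - 1}`: either the first letter is `0`, or all
letters are positive and can be lowered by one. -/
def sortedWords : ℕ → ℕ → Finset (List ℕ)
  | _, 0 => {[]}
  | 0, _ + 1 => ∅
  | k + 1, j + 1 => (sortedWords (k + 1) j).image (0 :: ·) ∪
      (sortedWords k (j + 1)).image (List.map (· + 1))

theorem mem_sortedWords {k j : ℕ} {w : List ℕ} :
    w ∈ sortedWords k j ↔ w.length = j ∧ w.Pairwise (· ≤ ·) ∧ ∀ a ∈ w, a < k := by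
  induction k, j using sortedWords.induct generalizing w with
  | case1 k =>
    rw [sortedWords, Finset.mem_singleton, List.length_eq_zero_iff]
    refine ⟨?_, And.left⟩
    rintro rfl
    simp
  | case2 j =>
    rw [sortedWords]
    rcases w with _ | ⟨a, w⟩
    · simp
    · exact iff_of_false (Finset.notMem_empty _)
        fun h => Nat.not_lt_zero _ (h.2.2 a List.mem_cons_self)
  | case3 k j ih1 ih2 =>
    rw [sortedWords, Finset.mem_union, Finset.mem_image, Finset.mem_image]
    constructor
    · rintro (⟨v, hv, rfl⟩ | ⟨v, hv, rfl⟩)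
      · rw [ih1] at hv
        simpa using hv
      · rw [ih2] at hv
        simpa [List.pairwise_map] using hv
    · rintro ⟨hl, hs, hb⟩
      rcases w with _ | ⟨a, w⟩
      · simp at hl
      rcases Nat.eq_zero_or_pos a with rfl | ha
      · refine Or.inl ⟨w, ih1.2 ⟨by simpa using hl, hs.of_cons, fun x hx => hb x (by simp [hx])⟩, rfl⟩
      · have hpos : ∀ x ∈ a :: w, 0 < x := by
          intro x hx
          rcases List.mem_cons.1 hx with rfl | hx
          · exact ha
          · exact ha.trans_le (List.rel_of_pairwise_cons hs hx)
        have hm : ((a :: w).map (· - 1)).map (· + 1) = a :: w := by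
          rw [List.map_map, List.map_congr_left (g := id), List.map_id]
          intro x hx
          have := hpos x hx
          simp only [Function.comp_apply, id]
          omega
        refine Or.inr ⟨(a :: w).map (· - 1), ih2.2 ⟨by simpa using hl, ?_, ?_⟩, hm⟩
        · exact hs.map _ fun x y h => Nat.sub_le_sub_right h 1
        · intro y hy
          obtain ⟨x, hx, rfl⟩ := List.mem_map.1 hy
          have := hpos x hx
          have := hb x hx
          omega

theorem qBinom_eq_zero {R : Type*} [CommSemiring R] (q : R) {n k : ℕ} (h : n < k) :
    qBinom q n k = 0 := by
  induction n, k using qBinom.induct with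
  | case1 n => omega
  | case2 k => rw [qBinom]
  | case3 n k ih1 ih2 => rw [qBinom, ih1 (by omega), ih2 (by omega)]; simp

/-- The complete symmetric function `h_j(1, q, …, q^{k-1})` is a `q`-binomial coefficient: the
recursion of `sortedWords` is the `q`-Pascal rule. -/
theorem sum_sortedWords {R : Type*} [CommSemiring R] (q : R) (k j : ℕ) :
    ∑ w ∈ sortedWords k j, q ^ w.sum = qBinom q (k + j - 1) j := by
  induction k, j using sortedWords.induct with
  | case1 k => simp [sortedWords, qBinom]
  | case2 j =>
    rw [sortedWords, Finset.sum_empty, qBinom_eq_zero q (by omega)]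
  | case3 k j ih1 ih2 =>
    rw [sortedWords, Finset.sum_union, Finset.sum_image, Finset.sum_image]
    · have e : k + 1 + (j + 1) - 1 = (k + j) + 1 := by omega
      rw [e, qBinom, show k + j = k + 1 + j - 1 by omega, ← ih1,
        show k + 1 + j - 1 = k + (j + 1) - 1 by omega, ← ih2, Finset.mul_sum]
      congr 1
      · simp
      · refine Finset.sum_congr rfl fun w hw => ?_
        rw [← pow_add, List.sum_map_add, List.map_id', ← (mem_sortedWords.1 hw).1]
        simp [add_comm]
    · exact (List.map_injective_iff.2 (add_left_injective 1)).injOn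
    · intro x _ y _ h
      simpa using h
    · rw [Finset.disjoint_left]
      intro x h1 h2
      obtain ⟨y, -, rfl⟩ := Finset.mem_image.1 h1
      obtain ⟨z, -, h⟩ := Finset.mem_image.1 h2
      have : 0 ∈ z.map (· + 1) := h ▸ List.mem_cons_self
      simp at this

/-! ### The codes of block-nondecreasing words -/

theorem removeCells_zero (I : Comp) : removeCells 0 I = I := by
  cases I with
  | nil => rfl
  | cons i I =>
    rw [removeCells, dif_pos i.pos]
    rfl

theorem removeCells_nil (m : ℕ) : removeCells m [] = [] := by rw [removeCells]

theorem removeCells_add (m n : ℕ) (I : Comp) :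
    removeCells (m + n) I = removeCells n (removeCells m I) := by
  induction I generalizing m n with
  | nil => simp only [removeCells_nil]
  | cons i I ih =>
    by_cases h : m < i
    · rw [removeCells.eq_2 m, dif_pos h]
      by_cases h' : m + n < i
      · rw [removeCells, dif_pos h', removeCells, dif_pos (by simp [Nat.toPNat]; omega)]
        congr 1
        apply PNat.eq
        simp [Nat.toPNat]
        omega
      · rw [removeCells, dif_neg h', removeCells, dif_neg (by simp [Nat.toPNat]; omega)]
        congr 1
        simp [Nat.toPNat]
        omega
    · rw [removeCells.eq_2 m, dif_neg h, removeCells, dif_neg (by omega), ← ih]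
      congr 1
      omega

theorem length_removeCells_le (m : ℕ) (I : Comp) : (removeCells m I).length ≤ I.length := by
  induction I generalizing m with
  | nil => simp [removeCells_nil]
  | cons i I ih =>
    rw [removeCells]
    split_ifs
    · simp
    · exact (ih _).trans (by simp)

theorem weight_removeCells (m : ℕ) (I : Comp) :
    Comp.weight (removeCells m I) = Comp.weight I - m := by
  induction I generalizing m with
  | nil => simp [removeCells_nil, Comp.weight]
  | cons i I ih =>
    rw [removeCells]
    split_ifs with h
    · rw [weight_cons, weight_cons, Nat.sub_add_comm h.le]
      rfl
    · rw [ih, weight_cons]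
      omega

theorem codeBound_append (I : Comp) (x y : List ℕ) :
    CodeBound I (x ++ y) ↔ CodeBound I x ∧ CodeBound (removeCells x.length I) y := by
  induction x generalizing I with
  | nil => simp [CodeBound, removeCells_zero]
  | cons a x ih =>
    rw [List.cons_append, CodeBound, CodeBound, ih, List.length_cons, Nat.add_comm,
      removeCells_add, and_assoc]

/-- For a nondecreasing word, the bounds on the entries of a code reduce to the last one. -/
theorem codeBound_iff_of_pairwise (I : Comp) {x : List ℕ} (hx : x.Pairwise (· ≤ ·)) :
    CodeBound I x ↔ ∀ a ∈ x, a < (removeCells (x.length - 1) I).length := by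
  induction x generalizing I with
  | nil => simp [CodeBound]
  | cons a x ih =>
    rw [CodeBound, ih _ hx.of_cons]
    cases x with
    | nil => simp [removeCells_zero]
    | cons b x =>
      rw [← removeCells_add, show 1 + ((b :: x).length - 1) = (a :: b :: x).length - 1 by
        simp [add_comm]]
      rw [List.forall_mem_cons (a := a)]
      refine ⟨fun h => ⟨?_, h.2⟩, fun h => ⟨h.1.trans_le (length_removeCells_le _ _), h.2⟩⟩
      exact (List.rel_of_pairwise_cons hx List.mem_cons_self).trans_lt (h.2 b List.mem_cons_self)

/-- The codes with bounds given by `I` that are nondecreasing on the blocks of `J`. -/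
def blockSortedCodes : Comp → Comp → Finset (List ℕ)
  | _, [] => {[]}
  | I, j :: J => (sortedWords (removeCells (j - 1) I).length j ×ˢ
      blockSortedCodes (removeCells j I) J).image fun p => p.1 ++ p.2

theorem mem_blockSortedCodes {I J : Comp} {c : List ℕ} :
    c ∈ blockSortedCodes I J ↔
      c.length = Comp.weight J ∧ BlockSorted J c ∧ CodeBound I c := by
  induction J generalizing I c with
  | nil =>
    rw [blockSortedCodes, Finset.mem_singleton]
    constructor
    · rintro rfl
      exact ⟨rfl, trivial, trivial⟩
    · rintro ⟨h, -⟩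
      exact List.length_eq_zero_iff.1 h
  | cons j J ih =>
    simp only [blockSortedCodes, Finset.mem_image, Finset.mem_product, mem_sortedWords, ih,
      BlockSorted, Prod.exists]
    constructor
    · rintro ⟨x, y, ⟨⟨hx1, hx2, hx3⟩, hy1, hy2, hy3⟩, rfl⟩
      rw [codeBound_append, codeBound_iff_of_pairwise I hx2, hx1, List.take_left' hx1,
        List.drop_left' hx1]
      exact ⟨by rw [List.length_append, weight_cons, hx1, hy1], ⟨hx2, hy2⟩, hx3, hy3⟩
    · rintro ⟨hl, ⟨hs1, hs2⟩, hb⟩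
      rw [weight_cons] at hl
      have h1 : (c.take j).length = j := by rw [List.length_take]; omega
      rw [← List.take_append_drop j c, codeBound_append, codeBound_iff_of_pairwise I hs1, h1] at hb
      exact ⟨_, _, ⟨⟨h1, hs1, hb.1⟩, by rw [List.length_drop]; omega, hs2, hb.2⟩,
        List.take_append_drop j c⟩

/-! ### The coefficients as products of `q`-binomial coefficients -/

section Coefficients

variable {F : Type*} [Field F] [CharZero F]

/-- Passing to codes turns the special inversion number into the sum of the entries, so that the
coefficient becomes a generating function of bounded block-nondecreasing sequences. -/
theorem coeffC_eq_sum_codes {q : F} (hq : q ≠ 0) {I J : Comp}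
    (h : Comp.weight I = Comp.weight J) :
    coeffC q I J = ∑ c ∈ blockSortedCodes I J, q ^ c.sum := by
  classical
  rw [coeffC_eq_sum_words hq]
  refine Finset.sum_nbij (fun z => wordCode z.1) (fun z hz => ?_) (fun u hu v hv huv => ?_)
    (fun c hc => ?_) fun z _ => by rw [sinv_eq_sum_wordCode]
  · obtain ⟨hz', rfl⟩ := Finset.mem_filter.1 hz
    obtain ⟨hl, hs⟩ := mem_blockSortedWords.1 hz'
    exact mem_blockSortedCodes.2 ⟨by rw [length_wordCode, hl], (blockSorted_wordCode _ _).2 hs,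
      codeBound_wordCode _⟩
  · exact packedWord_eq_of_wordCode_eq
      ((Finset.mem_filter.1 hu).2.trans (Finset.mem_filter.1 hv).2.symm) huv
  · obtain ⟨hl, hs, hb⟩ := mem_blockSortedCodes.1 hc
    obtain ⟨u, hu, rfl⟩ := exists_packedWord I c (hl.trans h.symm) hb
    refine ⟨u, Finset.mem_coe.2 (Finset.mem_filter.2 ⟨mem_blockSortedWords.2 ⟨?_, ?_⟩, hu⟩), rfl⟩
    · rw [← hl, length_wordCode]
    · exact (blockSorted_wordCode _ _).1 hs

theorem coeffC_nil {q : F} (hq : q ≠ 0) : coeffC q [] [] = 1 := by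
  rw [coeffC_eq_sum_codes hq rfl]
  simp [blockSortedCodes]

/-- Each block of `J` contributes one `q`-binomial coefficient, which depends only on the number
of parts of `I` that meet the cells from the end of the block on. -/
theorem coeffC_cons {q : F} (hq : q ≠ 0) {I : Comp} {j : ℕ+} {J : Comp}
    (h : Comp.weight I = Comp.weight (j :: J)) :
    coeffC q I (j :: J) = qBinom q ((removeCells (j - 1) I).length + j - 1) j *
      coeffC q (removeCells j I) J := by
  rw [coeffC_eq_sum_codes hq h,
    coeffC_eq_sum_codes hq (by rw [weight_removeCells, h, weight_cons, Nat.add_sub_cancel_left]),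
    blockSortedCodes, Finset.sum_image, ← sum_sortedWords, Finset.sum_mul_sum,
    Finset.sum_product]
  · simp only [List.sum_append, pow_add]
  · rintro ⟨x, y⟩ hx ⟨x', y'⟩ hx' e
    have h1 := (mem_sortedWords.1 (Finset.mem_product.1 hx).1).1
    have h2 := (mem_sortedWords.1 (Finset.mem_product.1 hx').1).1
    obtain ⟨rfl, rfl⟩ := List.append_inj e (h1.trans h2.symm)
    rfl

end Coefficients

/-- Merging two rows does not change the diagram that is left when more cells are removed than
the first row has. -/
theorem removeCells_merge (i₁ i₂ : ℕ+) (I : Comp) {m : ℕ} (hm : (i₁ : ℕ) ≤ m) :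
    removeCells m (i₁ :: i₂ :: I) = removeCells m ((i₁ + i₂) :: I) := by
  have : removeCells i₁ ((i₁ + i₂) :: I) = i₂ :: I := by
    rw [removeCells, dif_pos (by simp)]
    congr 1
    apply PNat.eq
    simp [Nat.toPNat]
  obtain ⟨n, rfl⟩ := Nat.exists_eq_add_of_le hm
  rw [removeCells_add, removeCells_add _ _ ((i₁ + i₂) :: I), this, removeCells,
    dif_neg (lt_irrefl _), Nat.sub_self, removeCells_zero]

/-- The pairs `(a, b)` of the `q`-binomial coefficients whose product is `C_I^J(q)`. -/
def binomPairs : Comp → Comp → List (ℕ × ℕ)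
  | _, [] => []
  | I, j :: J => ((removeCells (j - 1) I).length + j - 1, (j : ℕ)) ::
      binomPairs (removeCells j I) J

theorem snd_le_fst_of_mem_binomPairs {I J : Comp} (h : Comp.weight I = Comp.weight J) :
    ∀ p ∈ binomPairs I J, p.2 ≤ p.1 := by
  induction J generalizing I with
  | nil => simp [binomPairs]
  | cons j J ih =>
    have hj := j.pos
    intro p hp
    rcases List.mem_cons.1 hp with rfl | hp
    · have hne : removeCells (j - 1) I ≠ [] := by
        intro h0
        have := weight_removeCells (j - 1) I
        rw [h0, h, weight_cons] at this
        simp [Comp.weight] at this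
        omega
      have := List.length_pos_iff.2 hne
      simp only
      omega
    · exact ih (by rw [weight_removeCells, h, weight_cons, Nat.add_sub_cancel_left]) p hp

theorem coeffC_eq_prod {F : Type*} [Field F] [CharZero F] {q : F} (hq : q ≠ 0) {I J : Comp}
    (h : Comp.weight I = Comp.weight J) :
    coeffC q I J = ((binomPairs I J).map fun p => qBinom q p.1 p.2).prod := by
  induction J generalizing I with
  | nil =>
    have : I = [] := by
      cases I with
      | nil => rfl
      | cons i I =>
        have := i.pos
        simp only [Comp.weight, List.map_cons, List.sum_cons, List.map_nil, List.sum_nil] at h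
        omega
    rw [this, coeffC_nil hq]
    simp [binomPairs]
  | cons j J ih =>
    rw [coeffC_cons hq h, ih (by rw [weight_removeCells, h, weight_cons, Nat.add_sub_cancel_left]),
      binomPairs, List.map_cons, List.prod_cons]

end TevlinHL

theorem mainTheorem3 :
    (∀ (F : Type*) [Field F] [CharZero F] (q : F), q ≠ 0 →
      coeffC q [] [] = 1 ∧
      (∀ (i₁ i₂ j₁ : ℕ+) (I J : Comp),
        Comp.weight (i₁ :: i₂ :: I) = Comp.weight (j₁ :: J) → i₁ < j₁ →
        coeffC q (i₁ :: i₂ :: I) (j₁ :: J) = coeffC q ((i₁ + i₂) :: I) (j₁ :: J)) ∧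
      (∀ (i₁ j₁ : ℕ+) (I J : Comp),
        Comp.weight (i₁ :: I) = Comp.weight (j₁ :: J) → j₁ ≤ i₁ →
        coeffC q (i₁ :: I) (j₁ :: J) =
          qBinom q ((i₁ :: I).length + (j₁ : ℕ) - 1) j₁ *
            coeffC q (removeCells j₁ (i₁ :: I)) J)) ∧
    (∀ I J : Comp, Comp.weight I = Comp.weight J →
      ∃ L : List (ℕ × ℕ), (∀ p ∈ L, p.2 ≤ p.1) ∧
        ∀ (F : Type*) [Field F] [CharZero F] (q : F), q ≠ 0 →
          coeffC q I J = (L.map fun p => qBinom q p.1 p.2).prod) := by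
  refine ⟨fun F _ _ q hq => ⟨coeffC_nil hq, fun i₁ i₂ j₁ I J h hij => ?_,
    fun i₁ j₁ I J h hij => ?_⟩, fun I J h => ⟨binomPairs I J, snd_le_fst_of_mem_binomPairs h,
    fun F _ _ q hq => coeffC_eq_prod hq h⟩⟩
  · have hlt : (i₁ : ℕ) < j₁ := hij
    rw [coeffC_cons hq h, coeffC_cons hq (by rw [← h]; simp [Comp.weight, add_assoc]),
      removeCells_merge i₁ i₂ I (by omega), removeCells_merge i₁ i₂ I hlt.le]
  · have hle : (j₁ : ℕ) ≤ i₁ := hij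
    have hj := j₁.pos
    rw [coeffC_cons hq h, removeCells.eq_2 (j₁ - 1 : ℕ), dif_pos (by omega)]
    rfl
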